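/- **Theorem 1 (The central limit theorem).** Let $(\xi_n)_{n\ge 1}$ be a sequence of independent real random variables on a common probability space with finite second moments. Let $F_n$ be the distribution function of $\xi_n$ and put $m_n = E\xi_n$, $\sigma_n^2 = \operatorname{Var}\xi_n$, $S_n = \xi_1+\dots+\xi_n$ and $B_n^2 = \operatorname{Var} S_n = \sigma_1^2+\dots+\sigma_n^2$ with $B_n\ge 0$. For $s\ge 0$ let $$\alpha_n(s) = \frac{1}{\sigma_n^2}\int_{|x-m_n|\ge s} |x-m_n|^2\, dF_n(x) \quad\text{if } \sigma_n>0, \qquad \alpha_n(s)=0 \quad\text{if } \sigma_n=0.$$ Assume that 1. the sequence is non-singular, that is, at least one $\xi_n$ has a distribution that is neither degenerate (concentrated at one point) nor normal; 2. the uniform convergence condition holds: $\sup_{n} \alpha_n(s)\to 0$ as $s\to\infty$. Then the normalized sums $(S_n - ES_n)/B_n$ (defined for all sufficiently large $n$, since $B_n>0$ eventually by 1.) converge in distribution to the standard normal law $N(0,1)$ as $n\to\infty$ if and only if $B_n^2\to\infty$ as $n\to\infty$. -/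

import Mathlib

open MeasureTheory ProbabilityTheory Filter Topology

noncomputable section

namespace ShmyrovCLT

variable {Ω : Type*} [MeasurableSpace Ω]

/-- The law of `X` is concentrated at a single point. -/
def IsDegenerate (P : Measure Ω) (X : Ω → ℝ) : Prop :=
  ∃ c : ℝ, P.map X = Measure.dirac c

/-- The law of `X` is a normal distribution with positive variance. -/
def IsNormal (P : Measure Ω) (X : Ω → ℝ) : Prop :=
  ∃ (m : ℝ) (v : NNReal), v ≠ 0 ∧ P.map X = gaussianReal m v

/-- Every member of the sequence is degenerate or normal. -/
def IsSingular (P : Measure Ω) (ξ : ℕ → Ω → ℝ) : Prop :=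
  ∀ n, IsDegenerate P (ξ n) ∨ IsNormal P (ξ n)

open Classical in
/-- The normalized tail of the variance integral of `X`: with `m = E X`, `σ² = Var X`,
it is `σ⁻² ∫_{|x - m| ≥ s} |x - m|² dF(x)` if `σ² ≠ 0`, and `0` otherwise. -/
def varianceTail (P : Measure Ω) (X : Ω → ℝ) (s : ℝ) : ℝ :=
  if Var[X; P] = 0 then 0
  else (1 / Var[X; P]) * ∫ x in {x : ℝ | s ≤ |x - P[X]|}, |x - P[X]| ^ 2 ∂(P.map X)

/-- `sup_n α_n(s) → 0` as `s → ∞`. For square integrable variables every `α_n(s)` lies in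
`[0, 1]`, so the real supremum is the true one. -/
def UniformConvergenceCondition (P : Measure Ω) (ξ : ℕ → Ω → ℝ) : Prop :=
  Tendsto (fun s : ℝ => ⨆ n, varianceTail P (ξ n) s) atTop (𝓝 0)

/-- The sum of the first `n` members of the sequence; the members are `ξ 0, ξ 1, …`. -/
def partialSum (ξ : ℕ → Ω → ℝ) (n : ℕ) (ω : Ω) : ℝ :=
  ∑ k ∈ Finset.range n, ξ k ω

/-- The total variance `B_n² = Var S_n`. -/
def totalVariance (P : Measure Ω) (ξ : ℕ → Ω → ℝ) (n : ℕ) : ℝ :=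
  Var[partialSum ξ n; P]

/-- The normalized sum `(S_n - E S_n) / B_n`. -/
def normalizedSum (P : Measure Ω) (ξ : ℕ → Ω → ℝ) (n : ℕ) (ω : Ω) : ℝ :=
  (partialSum ξ n ω - P[partialSum ξ n]) / √(totalVariance P ξ n)

end ShmyrovCLT

end

/-
Necessity. If `B_n²` does not tend to infinity, it increases to a finite limit `L`, positive because
some `ξ k` is not degenerate. Each normalized sum then splits into `ξ k / B_n` and an independent
remainder. The first summand converges in law to `ξ k / √L`, so the remainders are tight, and a
cluster point of their laws gives a factorisation of `N(0, 1)` with the law of `ξ k / √L` as a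
factor. By Cramér's theorem every `ξ k` is Gaussian or degenerate, against non-singularity. The
reason for Cramér's theorem: the moment generating function of a factor of a Gaussian is entire,
without zeros and of order at most two, so it is the exponential of a quadratic polynomial.

Sufficiency. The Lindeberg sum of the normalized sequence at `ε` is
`B_n⁻² ∑ σ_k² α_k(ε B_n) ≤ sup_k α_k(ε B_n)`, which tends to zero as `B_n → ∞`.
-/

theorem exists_differentiable_exp_eq {f : ℂ → ℂ} (hf : Differentiable ℂ f) (hne : ∀ z, f z ≠ 0)
    {z₀ w : ℂ} (hw : Complex.exp w = f z₀) :
    ∃ g : ℂ → ℂ, Differentiable ℂ g ∧ g z₀ = w ∧ ∀ z, Complex.exp (g z) = f z := by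
  have hd : Differentiable ℂ fun z => deriv f z / f z :=
    hf.contDiff.differentiable_deriv_two.div hf hne
  obtain ⟨g, hg₀, hg⟩ := hd.isExactOn_univ.with_val_at z₀ w
  have hg' (z : ℂ) : HasDerivAt g (deriv f z / f z) z := hg z (Set.mem_univ z)
  have hquot (z : ℂ) : HasDerivAt (fun z => Complex.exp (g z) / f z) 0 z := by
    convert! (hg' z).cexp.div (hf z).hasDerivAt (hne z) using 1
    field_simp [hne z]
    ring
  refine ⟨g, fun z => (hg' z).differentiableAt, hg₀, fun z => ?_⟩
  have hconst : Complex.exp (g z) / f z = Complex.exp (g z₀) / f z₀ :=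
    is_const_of_deriv_eq_zero (fun z => (hquot z).differentiableAt) (fun z => (hquot z).deriv) z z₀
  rwa [hg₀, hw, div_self (hne z₀), div_eq_one_iff_eq (hne z)] at hconst

section PolynomialGrowth

variable {f : ℂ → ℂ} {C : ℝ} {k : ℕ}

theorem iteratedDeriv_eq_zero_of_norm_le_pow (hf : Differentiable ℂ f)
    (hbound : ∀ z, ‖f z‖ ≤ C * (1 + ‖z‖) ^ k) {n : ℕ} (hkn : k < n) :
    iteratedDeriv n f 0 = 0 := by
  have hC : 0 ≤ C := by simpa using (norm_nonneg _).trans (hbound 0)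
  have hcauchy {r : ℝ} (hr : 1 ≤ r) :
      ‖iteratedDeriv n f 0‖ ≤ n.factorial * (C * 2 ^ k) * r⁻¹ := by
    have hr₀ : 0 < r := by positivity
    calc ‖iteratedDeriv n f 0‖ ≤ n.factorial * (C * (1 + r) ^ k) / r ^ n :=
          Complex.norm_iteratedDeriv_le_of_forall_mem_sphere_norm_le n hr₀ hf.diffContOnCl
            fun z hz => by simpa [mem_sphere_zero_iff_norm.1 hz] using hbound z
      _ ≤ n.factorial * (C * (2 * r) ^ k) / r ^ (k + 1) := by
          gcongr
          · linarith
          · exact hkn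
      _ = n.factorial * (C * 2 ^ k) * r⁻¹ := by
          rw [mul_pow, pow_succ]
          field_simp
  have hlim : Tendsto (fun r : ℝ => n.factorial * (C * 2 ^ k) * r⁻¹) atTop (𝓝 0) := by
    simpa using tendsto_inv_atTop_zero.const_mul (n.factorial * (C * 2 ^ k))
  exact norm_le_zero_iff.1 <| ge_of_tendsto hlim <|
    (eventually_ge_atTop 1).mono fun r hr => hcauchy hr

theorem eq_sum_range_of_norm_le_pow (hf : Differentiable ℂ f)
    (hbound : ∀ z, ‖f z‖ ≤ C * (1 + ‖z‖) ^ k) (z : ℂ) :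
    f z = ∑ n ∈ Finset.range (k + 1), (n.factorial : ℂ)⁻¹ * iteratedDeriv n f 0 * z ^ n := by
  rw [← Complex.taylorSeries_eq_of_entire' 0 z hf, tsum_eq_sum (s := Finset.range (k + 1))]
  · simp only [sub_zero]
  · intro n hn
    rw [iteratedDeriv_eq_zero_of_norm_le_pow hf hbound (by simpa [Nat.lt_succ_iff] using hn)]
    ring

theorem norm_le_pow_of_re_le_pow (hf : Differentiable ℂ f) (hf₀ : f 0 = 0) (hC : 0 < C)
    (hre : ∀ z, (f z).re ≤ C * (1 + ‖z‖) ^ k) (z : ℂ) :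
    ‖f z‖ ≤ 2 ^ (k + 1) * C * (1 + ‖z‖) ^ k := by
  rcases eq_or_ne z 0 with rfl | hz
  · rw [hf₀, norm_zero]
    positivity
  have hz₀ : 0 < ‖z‖ := norm_pos_iff.2 hz
  calc ‖f z‖ ≤ 2 * (C * (1 + 2 * ‖z‖) ^ k) * ‖z‖ / (2 * ‖z‖ - ‖z‖) := by
        refine Complex.borelCaratheodory_zero (by positivity) hf.differentiableOn
          (fun w hw => (hre w).trans ?_) (by positivity) (by simpa using by linarith) hf₀
        gcongr
        exact (mem_ball_zero_iff.1 hw).le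
    _ = 2 * C * (1 + 2 * ‖z‖) ^ k := by
        field_simp
        ring
    _ ≤ 2 * C * (2 * (1 + ‖z‖)) ^ k := by
        gcongr
        linarith
    _ = 2 ^ (k + 1) * C * (1 + ‖z‖) ^ k := by
        rw [mul_pow]
        ring

theorem eq_sum_range_of_re_le_pow (hf : Differentiable ℂ f) (hf₀ : f 0 = 0) (hC : 0 < C)
    (hre : ∀ z, (f z).re ≤ C * (1 + ‖z‖) ^ k) (z : ℂ) :
    f z = ∑ n ∈ Finset.range (k + 1), (n.factorial : ℂ)⁻¹ * iteratedDeriv n f 0 * z ^ n :=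
  eq_sum_range_of_norm_le_pow hf (norm_le_pow_of_re_le_pow hf hf₀ hC hre) z

end PolynomialGrowth

section Cramer

variable {μ ν : Measure ℝ}

theorem integrable_exp_mul_left_of_conv [SFinite μ] [SFinite ν] [NeZero ν] {t : ℝ}
    (h : Integrable (fun x => Real.exp (t * x)) (μ ∗ ν)) :
    Integrable (fun x => Real.exp (t * x)) μ := by
  have h' := (integrable_map_measure (by fun_prop) (by fun_prop)).1 h
  obtain ⟨y, hy⟩ := h'.prod_left_ae.exists
  simp only [Function.comp_def, mul_add, Real.exp_add] at hy
  exact (integrable_mul_const_iff (Real.exp_pos (t * y)).ne'.isUnit _).1 hy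

theorem complexMGF_id_conv [SFinite μ] [SFinite ν] {z : ℂ}
    (h : Integrable (fun x => Real.exp (z.re * x)) (μ ∗ ν)) :
    complexMGF id (μ ∗ ν) z = complexMGF id μ z * complexMGF id ν z := by
  have hint : Integrable (fun x : ℝ => Complex.exp (z * x)) (μ ∗ ν) := by
    rw [← integrable_norm_iff (by fun_prop)]
    simpa [Complex.norm_exp] using h
  simp only [complexMGF, id]
  rw [integral_conv hint, ← integral_mul_const]
  congr with x
  rw [← integral_const_mul]
  congr with y
  rw [← Complex.exp_add, Complex.ofReal_add, mul_add]

theorem exp_mul_integral_le_mgf {Ω : Type*} [MeasurableSpace Ω] {P : Measure Ω}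
    [IsProbabilityMeasure P] {X : Ω → ℝ} {t : ℝ} (hX : Integrable X P)
    (hexp : Integrable (fun ω => Real.exp (t * X ω)) P) : Real.exp (t * P[X]) ≤ mgf X P t := by
  rw [← integral_const_mul]
  exact convexOn_exp.map_integral_le Real.continuous_exp.continuousOn isClosed_univ
    (ae_of_all _ fun _ => Set.mem_univ _) (hX.const_mul t) hexp

variable [IsProbabilityMeasure μ] [IsProbabilityMeasure ν]

theorem mgf_id_le_of_conv_eq_gaussianReal {m : ℝ} {v : NNReal}
    (h : μ ∗ ν = gaussianReal m v) (t : ℝ) :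
    mgf id μ t ≤ Real.exp ((m - ν[id]) * t + v * t ^ 2 / 2) := by
  have hconv (t : ℝ) : Integrable (fun x => Real.exp (t * x)) (μ ∗ ν) :=
    h ▸ integrable_exp_mul_gaussianReal t
  have hν (t : ℝ) : Integrable (fun x => Real.exp (t * x)) ν :=
    integrable_exp_mul_left_of_conv (Measure.conv_comm μ ν ▸ hconv t)
  have hmul : mgf id μ t * mgf id ν t = Real.exp (m * t + v * t ^ 2 / 2) := by
    have := complexMGF_id_conv (z := t) (hconv t)
    rw [h, complexMGF_ofReal, complexMGF_ofReal, complexMGF_ofReal, mgf_id_gaussianReal] at this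
    exact_mod_cast this.symm
  have hmean : Integrable (fun x => x) ν := by
    simpa using integrable_pow_of_integrable_exp_mul one_ne_zero (hν 1) (hν (-1)) 1
  have hjensen : Real.exp (t * ν[id]) ≤ mgf id ν t := exp_mul_integral_le_mgf hmean (hν t)
  calc mgf id μ t = Real.exp (m * t + v * t ^ 2 / 2) / mgf id ν t := by
        rw [← hmul, mul_div_cancel_right₀ _ (mgf_pos (X := id) (hν t)).ne']
    _ ≤ Real.exp (m * t + v * t ^ 2 / 2) / Real.exp (t * ν[id]) := by gcongr
    _ = Real.exp ((m - ν[id]) * t + v * t ^ 2 / 2) := by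
        rw [← Real.exp_sub]
        ring_nf

theorem integrableExpSet_eq_univ_of_complexMGF_ne_zero {Ω : Type*} [MeasurableSpace Ω]
    {P : Measure Ω} {X : Ω → ℝ} (h : ∀ z, complexMGF X P z ≠ 0) :
    integrableExpSet X P = Set.univ := by
  refine Set.eq_univ_of_forall fun t => not_imp_comm.1 mgf_undef ?_
  simpa only [complexMGF_ofReal, ne_eq, Complex.ofReal_eq_zero] using h t

theorem isGaussian_of_complexMGF_eq_exp {a b : ℂ}
    (h : ∀ z, complexMGF id μ z = Complex.exp (a * z + b * z ^ 2)) : IsGaussian μ := by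
  have hset : integrableExpSet id μ = Set.univ :=
    integrableExpSet_eq_univ_of_complexMGF_ne_zero fun z => h z ▸ Complex.exp_ne_zero _
  have hmgf (t : ℝ) : mgf id μ t = Real.exp (a.re * t + b.re * t ^ 2) := by
    rw [← Real.norm_of_nonneg mgf_nonneg, ← Complex.norm_real, ← complexMGF_ofReal, h,
      Complex.norm_exp]
    simp [pow_two]
  have hb : 0 ≤ b.re := by
    have hchar (t : ℝ) : (a * (t * Complex.I) + b * (t * Complex.I) ^ 2).re ≤ 0 := by
      rw [← Real.exp_le_one_iff, ← Complex.norm_exp, ← h, complexMGF_id_mul_I]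
      exact norm_charFun_le_one t
    have h₁ : -a.im ≤ b.re := by simpa [pow_two] using hchar 1
    have h₂ : a.im ≤ b.re := by simpa [pow_two] using hchar (-1)
    linarith
  have hgauss : mgf id μ = mgf id (gaussianReal a.re (2 * b.re).toNNReal) := by
    ext t
    rw [hmgf, mgf_id_gaussianReal, Real.coe_toNNReal _ (by positivity)]
    ring_nf
  have hμ : μ = gaussianReal a.re (2 * b.re).toNNReal :=
    Measure.ext_of_complexMGF_id_eq <| funext fun z =>
      eqOn_complexMGF_of_mgf hgauss (by simp [hset])
  exact hμ ▸ isGaussian_gaussianReal _ _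

theorem isGaussian_of_mgf_le {C : ℝ} (hC : 0 < C) (hne : ∀ z, complexMGF id μ z ≠ 0)
    (hle : ∀ t, mgf id μ t ≤ Real.exp (C * (1 + |t|) ^ 2)) : IsGaussian μ := by
  have hdiff : Differentiable ℂ (complexMGF id μ) := fun z =>
    (hasDerivAt_complexMGF
      (by simp [integrableExpSet_eq_univ_of_complexMGF_ne_zero hne])).differentiableAt
  obtain ⟨g, hg, hg₀, hexp⟩ := exists_differentiable_exp_eq hdiff hne (z₀ := 0) (w := 0)
    (by simp [complexMGF])
  have hre (z : ℂ) : (g z).re ≤ C * (1 + ‖z‖) ^ 2 := by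
    rw [← Real.exp_le_exp, ← Complex.norm_exp, hexp]
    refine norm_complexMGF_le_mgf.trans ((hle z.re).trans ?_)
    gcongr
    exact Complex.abs_re_le_norm z
  refine isGaussian_of_complexMGF_eq_exp (a := iteratedDeriv 1 g 0) (b := iteratedDeriv 2 g 0 / 2)
    fun z => ?_
  rw [← hexp, eq_sum_range_of_re_le_pow hg hg₀ hC hre]
  simp [Finset.sum_range_succ, hg₀, div_eq_inv_mul]

theorem isGaussian_of_conv_eq_gaussianReal {m : ℝ} {v : NNReal}
    (h : μ ∗ ν = gaussianReal m v) : IsGaussian μ := by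
  set d := m - ν[id]
  refine isGaussian_of_mgf_le (C := |d| + v + 1) (by positivity) (fun z => ?_) fun t => ?_
  · refine left_ne_zero_of_mul (b := complexMGF id ν z) ?_
    rw [← complexMGF_id_conv (h ▸ integrable_exp_mul_gaussianReal z.re), h,
      complexMGF_id_gaussianReal]
    exact Complex.exp_ne_zero _
  · refine (mgf_id_le_of_conv_eq_gaussianReal h t).trans (Real.exp_le_exp.2 ?_)
    calc d * t + v * t ^ 2 / 2 ≤ |d| * |t| + v * |t| ^ 2 := by
          have : d * t ≤ |d| * |t| := (le_abs_self _).trans_eq (abs_mul d t)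
          have : 0 ≤ v * t ^ 2 := by positivity
          rw [sq_abs]
          linarith
      _ ≤ |d| * (1 + |t|) ^ 2 + v * (1 + |t|) ^ 2 := by
          gcongr
          · nlinarith [abs_nonneg t]
          · linarith
      _ ≤ (|d| + v + 1) * (1 + |t|) ^ 2 := by
          nlinarith [sq_nonneg (1 + |t|)]

end Cramer

theorem isGaussian_of_isGaussian_conv {E : Type*} [NormedAddCommGroup E] [NormedSpace ℝ E]
    [MeasurableSpace E] [BorelSpace E] [SecondCountableTopology E] {μ ν : Measure E}
    [IsProbabilityMeasure μ] [IsProbabilityMeasure ν] (h : IsGaussian (μ ∗ ν)) :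
    IsGaussian μ := by
  refine isGaussian_of_isGaussian_map fun L => ?_
  have hμ : IsProbabilityMeasure (μ.map L) := Measure.isProbabilityMeasure_map (by fun_prop)
  have hν : IsProbabilityMeasure (ν.map L) := Measure.isProbabilityMeasure_map (by fun_prop)
  refine isGaussian_of_conv_eq_gaussianReal (ν := ν.map L) (m := (μ ∗ ν)[L])
    (v := Var[L; μ ∗ ν].toNNReal) ?_
  rw [← Measure.map_conv_continuousLinearMap]
  exact h.map_eq_gaussianReal L

theorem isTightMeasureSet_range_of_tendsto {E : Type*} [PseudoMetricSpace E] [CompleteSpace E]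
    [SecondCountableTopology E] [MeasurableSpace E] [BorelSpace E] {μ : ℕ → ProbabilityMeasure E}
    {μ₀ : ProbabilityMeasure E} (h : Tendsto μ atTop (𝓝 μ₀)) :
    IsTightMeasureSet (Set.range fun n => (μ n : Measure E)) := by
  have hcompact : IsCompact (closure (Set.range μ)) :=
    h.isCompact_insert_range.closure_of_subset (Set.subset_insert _ _)
  refine (isTightMeasureSet_of_isCompact_closure hcompact).subset ?_
  rintro _ ⟨n, rfl⟩
  exact ⟨μ n, Set.mem_range_self n, rfl⟩

theorem isTightMeasureSet_range_of_conv {ι E : Type*} [AddCommGroup E] [TopologicalSpace E]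
    [IsTopologicalAddGroup E] [SecondCountableTopology E] [T2Space E] [MeasurableSpace E]
    [BorelSpace E] {μ ν : ι → Measure E} [∀ i, IsProbabilityMeasure (μ i)]
    [∀ i, IsProbabilityMeasure (ν i)] (hμ : IsTightMeasureSet (Set.range μ))
    (hconv : IsTightMeasureSet (Set.range fun i => μ i ∗ ν i)) :
    IsTightMeasureSet (Set.range ν) := by
  let κ (i : ι) : Measure (E × E) := ((μ i).prod (ν i)).map fun p => (p.1, p.1 + p.2)
  have hfst (i : ι) : (κ i).fst = μ i := by
    rw [Measure.fst_map_prodMk (by fun_prop)]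
    exact Measure.fst_prod
  have hsnd (i : ι) : (κ i).snd = μ i ∗ ν i := Measure.snd_map_prodMk (by fun_prop)
  have hsub (i : ι) : (κ i).map (fun p => p.2 - p.1) = ν i := by
    rw [Measure.map_map (by fun_prop) (by fun_prop)]
    simp only [Function.comp_def, add_sub_cancel_left]
    exact Measure.snd_prod
  have hκ : IsTightMeasureSet (Set.range κ) := by
    apply IsTightMeasureSet.prodMk
    · simpa only [← Set.range_comp, Function.comp_def, hfst] using hμ
    · simpa only [← Set.range_comp, Function.comp_def, hsnd] using hconv
  simpa only [← Set.range_comp, Function.comp_def, hsub] using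
    hκ.map (f := fun p : E × E => p.2 - p.1) (by fun_prop)

section WeakLimits

variable {E : Type*} [NormedAddCommGroup E] [InnerProductSpace ℝ E] [MeasurableSpace E]
  [BorelSpace E]

theorem tendsto_charFun_of_tendsto {ι : Type*} {l : Filter ι} {μ : ι → ProbabilityMeasure E}
    {μ₀ : ProbabilityMeasure E} (h : Tendsto μ l (𝓝 μ₀)) (t : E) :
    Tendsto (fun i => charFun (μ i : Measure E) t) l (𝓝 (charFun (μ₀ : Measure E) t)) := by
  simp_rw [charFun_eq_integral_innerProbChar]
  exact (ProbabilityMeasure.tendsto_iff_forall_integral_rclike_tendsto ℂ).1 h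
    (BoundedContinuousFunction.innerProbChar t)

theorem exists_conv_eq_of_tendsto [SecondCountableTopology E] [CompleteSpace E]
    {μ ν ρ : ℕ → ProbabilityMeasure E} {μ₀ ρ₀ : ProbabilityMeasure E}
    (hμ : Tendsto μ atTop (𝓝 μ₀)) (hρ : Tendsto ρ atTop (𝓝 ρ₀))
    (hconv : ∀ n, (μ n : Measure E) ∗ (ν n : Measure E) = ρ n) :
    ∃ ν₀ : ProbabilityMeasure E, (μ₀ : Measure E) ∗ (ν₀ : Measure E) = ρ₀ := by
  have hν : IsTightMeasureSet (Set.range fun n => (ν n : Measure E)) :=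
    isTightMeasureSet_range_of_conv (isTightMeasureSet_range_of_tendsto hμ)
      (by simpa only [hconv] using isTightMeasureSet_range_of_tendsto hρ)
  have htight : IsTightMeasureSet {((κ : ProbabilityMeasure E) : Measure E) | κ ∈ Set.range ν} := by
    refine hν.subset ?_
    rintro _ ⟨_, ⟨n, rfl⟩, rfl⟩
    exact ⟨n, rfl⟩
  obtain ⟨ν₀, -, hν₀⟩ :=
    (isCompact_closure_of_isTightMeasureSet htight).exists_mapClusterPt (f := atTop) (u := ν)
      (tendsto_principal.2 (.of_forall fun n => subset_closure (Set.mem_range_self n)))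
  obtain ⟨U, hU, hνU⟩ := mapClusterPt_iff_ultrafilter.1 hν₀
  refine ⟨ν₀, Measure.ext_of_charFun (funext fun t => ?_)⟩
  rw [charFun_conv]
  refine tendsto_nhds_unique ((tendsto_charFun_of_tendsto (hμ.mono_left hU) t).mul
    (tendsto_charFun_of_tendsto hνU t)) ?_
  simpa only [← charFun_conv, hconv] using tendsto_charFun_of_tendsto (hρ.mono_left hU) t

end WeakLimits

section ExponentialEstimates

theorem norm_prod_sub_prod_le {ι R : Type*} [NormedCommRing R] [NormOneClass R]
    {s : Finset ι} {a b : ι → R} (ha : ∀ i ∈ s, ‖a i‖ ≤ 1) (hb : ∀ i ∈ s, ‖b i‖ ≤ 1) :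
    ‖∏ i ∈ s, a i - ∏ i ∈ s, b i‖ ≤ ∑ i ∈ s, ‖a i - b i‖ := by
  induction s using Finset.cons_induction with
  | empty => simp
  | cons i s hi ih =>
    rw [Finset.forall_mem_cons] at ha hb
    rw [Finset.prod_cons, Finset.prod_cons, Finset.sum_cons]
    have hs : ‖∏ j ∈ s, a j‖ ≤ 1 :=
      (Finset.norm_prod_le _ _).trans (Finset.prod_le_one (fun _ _ => norm_nonneg _) ha.2)
    calc ‖a i * ∏ j ∈ s, a j - b i * ∏ j ∈ s, b j‖
        = ‖(a i - b i) * ∏ j ∈ s, a j + b i * (∏ j ∈ s, a j - ∏ j ∈ s, b j)‖ := by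
          congr 1; ring
      _ ≤ ‖a i - b i‖ * ‖∏ j ∈ s, a j‖ + ‖b i‖ * ‖∏ j ∈ s, a j - ∏ j ∈ s, b j‖ :=
          (norm_add_le _ _).trans (add_le_add (norm_mul_le _ _) (norm_mul_le _ _))
      _ ≤ ‖a i - b i‖ * 1 + 1 * ∑ j ∈ s, ‖a j - b j‖ := by
          gcongr
          exacts [hb.1, ih ha.2 hb.2]
      _ = ‖a i - b i‖ + ∑ j ∈ s, ‖a j - b j‖ := by ring

theorem norm_exp_mul_I_sub_quadratic_le (y : ℝ) :
    ‖Complex.exp (y * Complex.I) - ((1 - y ^ 2 / 2 : ℝ) + y * Complex.I)‖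
      ≤ 4 * (y ^ 2 * min 1 |y|) := by
  obtain hy | hy := le_total |y| 1
  · have htaylor : ∑ m ∈ Finset.range 3, (y * Complex.I) ^ m / (m.factorial : ℂ)
        = (1 - y ^ 2 / 2 : ℝ) + y * Complex.I := by
      simp only [Finset.sum_range_succ, Finset.sum_range_zero, Nat.factorial, mul_pow,
        Complex.I_sq]
      push_cast
      ring
    have hexp : Real.exp |y| ≤ 4 :=
      (Real.exp_le_exp.2 hy).trans (Real.exp_one_lt_d9.le.trans (by norm_num))
    calc ‖Complex.exp (y * Complex.I) - ((1 - y ^ 2 / 2 : ℝ) + y * Complex.I)‖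
        ≤ ‖y * Complex.I‖ ^ 3 * Real.exp ‖y * Complex.I‖ := by
          rw [← htaylor]
          exact Complex.norm_exp_sub_sum_le_norm_mul_exp (y * Complex.I) 3
      _ = |y| ^ 3 * Real.exp |y| := by simp
      _ ≤ |y| ^ 3 * 4 := by gcongr
      _ = 4 * (y ^ 2 * min 1 |y|) := by rw [min_eq_right hy, ← sq_abs y]; ring
  · calc ‖Complex.exp (y * Complex.I) - ((1 - y ^ 2 / 2 : ℝ) + y * Complex.I)‖
        ≤ ‖Complex.exp (y * Complex.I)‖ + (‖((1 - y ^ 2 / 2 : ℝ) : ℂ)‖ + ‖y * Complex.I‖) :=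
          norm_sub_le_of_le le_rfl (norm_add_le _ _)
      _ = 1 + (|1 - y ^ 2 / 2| + |y|) := by
          rw [Complex.norm_exp_ofReal_mul_I, Complex.norm_real, norm_mul, Complex.norm_real,
            Complex.norm_I, mul_one, Real.norm_eq_abs, Real.norm_eq_abs]
      _ ≤ 1 + ((1 + |y| ^ 2 / 2) + |y|) := by
          rw [sq_abs]
          gcongr
          rw [abs_le]
          constructor <;> linarith [sq_nonneg y]
      _ ≤ 4 * |y| ^ 2 := by nlinarith
      _ = 4 * (y ^ 2 * min 1 |y|) := by rw [min_eq_left hy, sq_abs, mul_one]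

theorem abs_exp_neg_sub_one_sub_le_sq {x : ℝ} (hx : 0 ≤ x) :
    |Real.exp (-x) - (1 - x)| ≤ x ^ 2 := by
  obtain h | h := le_total x 1
  · have := Real.abs_exp_sub_one_sub_id_le (x := -x) (by rwa [abs_neg, abs_of_nonneg hx])
    rwa [neg_sq, sub_sub, ← sub_eq_add_neg] at this
  · rw [abs_le]
    have := Real.add_one_le_exp (-x)
    have := Real.exp_le_one_iff.2 (neg_nonpos.2 hx)
    constructor <;> nlinarith

theorem sq_mul_min_one_abs_le {ε : ℝ} (hε : 0 ≤ ε) (t x : ℝ) :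
    (t * x) ^ 2 * min 1 |t * x|
      ≤ |t| ^ 3 * ε * x ^ 2 + t ^ 2 * {x : ℝ | ε ≤ |x|}.indicator (fun x => x ^ 2) x := by
  by_cases hx : x ∈ {x : ℝ | ε ≤ |x|}
  · rw [Set.indicator_of_mem hx]
    calc (t * x) ^ 2 * min 1 |t * x| ≤ (t * x) ^ 2 * 1 := by gcongr; exact min_le_left _ _
      _ = 0 + t ^ 2 * x ^ 2 := by ring
      _ ≤ |t| ^ 3 * ε * x ^ 2 + t ^ 2 * x ^ 2 := by gcongr; positivity
  · rw [Set.indicator_of_notMem hx, mul_zero, add_zero]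
    have hmin : min 1 |t * x| ≤ |t| * ε := (min_le_right _ _).trans <| by
      rw [abs_mul]
      gcongr
      exact (not_le.1 hx).le
    calc (t * x) ^ 2 * min 1 |t * x| ≤ (t * x) ^ 2 * (|t| * ε) := by gcongr
      _ = |t| ^ 3 * ε * x ^ 2 := by rw [mul_pow, ← sq_abs t]; ring

end ExponentialEstimates

/-- The truncated second moment `∫_{|x| ≥ ε} x² dμ`, the quantity that Lindeberg's condition
requires to vanish when summed over a row. -/
noncomputable def tailSecondMoment (μ : Measure ℝ) (ε : ℝ) : ℝ :=
  ∫ x in {x | ε ≤ |x|}, x ^ 2 ∂μ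

section CenteredLaw

theorem measurableSet_le_abs (ε : ℝ) : MeasurableSet {x : ℝ | ε ≤ |x|} :=
  measurableSet_le measurable_const measurable_id.abs

theorem tailSecondMoment_nonneg (μ : Measure ℝ) (ε : ℝ) : 0 ≤ tailSecondMoment μ ε :=
  integral_nonneg fun x => sq_nonneg x

theorem tailSecondMoment_map {Ω : Type*} [MeasurableSpace Ω] {P : Measure Ω} {X : Ω → ℝ}
    (hX : AEMeasurable X P) (ε : ℝ) :
    tailSecondMoment (P.map X) ε = ∫ ω in {ω | ε ≤ |X ω|}, X ω ^ 2 ∂P :=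
  setIntegral_map (measurableSet_le_abs ε) (by fun_prop) hX

variable {μ : Measure ℝ}

theorem variance_id_eq_integral_sq (h0 : ∫ x, x ∂μ = 0) : Var[id; μ] = ∫ x, x ^ 2 ∂μ :=
  variance_of_integral_eq_zero aemeasurable_id h0

variable [IsProbabilityMeasure μ]

theorem integrable_one_sub_sq_div_two (hμ : MemLp id 2 μ) (t : ℝ) :
    Integrable (fun x : ℝ => ((1 - (t * x) ^ 2 / 2 : ℝ) : ℂ)) μ :=
  ((integrable_const 1).sub ((hμ.const_mul t).integrable_sq.div_const 2)).ofReal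

theorem integrable_const_mul_mul_I (hμ : MemLp id 2 μ) (t : ℝ) :
    Integrable (fun x : ℝ => ((t * x : ℝ) : ℂ) * Complex.I) μ :=
  ((hμ.const_mul t).integrable one_le_two).ofReal.mul_const Complex.I

theorem integral_quadratic_of_integral_eq_zero (hμ : MemLp id 2 μ) (h0 : ∫ x, x ∂μ = 0) (t : ℝ) :
    ∫ x : ℝ, ((1 - (t * x) ^ 2 / 2 : ℝ) + (t * x : ℝ) * Complex.I) ∂μ
      = 1 - ((Var[id; μ] * t ^ 2 / 2 : ℝ) : ℂ) := by
  have hre : ∫ x : ℝ, (1 - (t * x) ^ 2 / 2) ∂μ = 1 - Var[id; μ] * t ^ 2 / 2 := by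
    have hsq : Integrable (fun x : ℝ => (t * x) ^ 2) μ := (hμ.const_mul t).integrable_sq
    rw [integral_sub (integrable_const 1) (hsq.div_const 2)]
    simp only [mul_pow, integral_div, integral_const_mul, integral_const, probReal_univ, one_smul,
      variance_id_eq_integral_sq h0]
    ring
  have him : ∫ x : ℝ, t * x ∂μ = 0 := by rw [integral_const_mul, h0, mul_zero]
  rw [integral_add (integrable_one_sub_sq_div_two hμ t) (integrable_const_mul_mul_I hμ t),
    integral_mul_const, integral_complex_ofReal, integral_complex_ofReal, hre, him]
  push_cast
  ring

theorem norm_charFun_sub_quadratic_le (hμ : MemLp id 2 μ) (h0 : ∫ x, x ∂μ = 0) (t : ℝ) {ε : ℝ}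
    (hε : 0 ≤ ε) :
    ‖charFun μ t - (1 - ((Var[id; μ] * t ^ 2 / 2 : ℝ) : ℂ))‖
      ≤ 4 * |t| ^ 3 * ε * Var[id; μ] + 4 * t ^ 2 * tailSecondMoment μ ε := by
  have hsq : Integrable (fun x : ℝ => x ^ 2) μ := hμ.integrable_sq
  have htail := hsq.indicator (measurableSet_le_abs ε)
  have hexp : Integrable (fun x : ℝ => Complex.exp ((t * x : ℝ) * Complex.I)) μ :=
    .of_bound (by fun_prop) 1 (ae_of_all _ fun x => (Complex.norm_exp_ofReal_mul_I _).le)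
  have hcharFun : charFun μ t = ∫ x : ℝ, Complex.exp ((t * x : ℝ) * Complex.I) ∂μ := by
    simp only [charFun_apply_real, Complex.ofReal_mul]
  have hquad : Integrable
      (fun x : ℝ => ((1 - (t * x) ^ 2 / 2 : ℝ) + (t * x : ℝ) * Complex.I : ℂ)) μ :=
    (integrable_one_sub_sq_div_two hμ t).add (integrable_const_mul_mul_I hμ t)
  rw [hcharFun, ← integral_quadratic_of_integral_eq_zero hμ h0, ← integral_sub hexp hquad,
    variance_id_eq_integral_sq h0, tailSecondMoment,
    ← integral_indicator (measurableSet_le_abs ε), ← integral_const_mul, ← integral_const_mul,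
    ← integral_add (hsq.const_mul _) (htail.const_mul _)]
  refine norm_integral_le_of_norm_le ((hsq.const_mul _).add (htail.const_mul _))
    (ae_of_all _ fun x => (norm_exp_mul_I_sub_quadratic_le (t * x)).trans ?_)
  linarith [sq_mul_min_one_abs_le hε t x]

theorem variance_le_sq_add_tailSecondMoment (hμ : MemLp id 2 μ) (h0 : ∫ x, x ∂μ = 0) (ε : ℝ) :
    Var[id; μ] ≤ ε ^ 2 + tailSecondMoment μ ε := by
  have hsq : Integrable (fun x : ℝ => x ^ 2) μ := hμ.integrable_sq
  have htail := hsq.indicator (measurableSet_le_abs ε)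
  calc Var[id; μ] = ∫ x, x ^ 2 ∂μ := variance_id_eq_integral_sq h0
    _ ≤ ∫ x, (ε ^ 2 + {x | ε ≤ |x|}.indicator (fun x => x ^ 2) x) ∂μ := by
        refine integral_mono hsq ((integrable_const _).add htail) fun x => ?_
        by_cases hx : ε ≤ |x|
        · simpa [Set.indicator_of_mem, hx] using sq_nonneg ε
        · simpa [Set.indicator_of_notMem, hx] using
            sq_le_sq.2 ((not_le.1 hx).le.trans (le_abs_self ε))
    _ = ε ^ 2 + tailSecondMoment μ ε := by
        rw [integral_add (integrable_const _) htail, integral_indicator (measurableSet_le_abs ε),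
          integral_const, probReal_univ, one_smul, tailSecondMoment]

theorem norm_charFun_sub_exp_le (hμ : MemLp id 2 μ) (h0 : ∫ x, x ∂μ = 0) (t : ℝ) {ε : ℝ}
    (hε : 0 ≤ ε) :
    ‖charFun μ t - Complex.exp (-(Var[id; μ] * t ^ 2 / 2 : ℝ))‖
      ≤ 4 * |t| ^ 3 * ε * Var[id; μ] + 4 * t ^ 2 * tailSecondMoment μ ε
        + t ^ 4 / 4 * (Var[id; μ] * (ε ^ 2 + tailSecondMoment μ ε)) := by
  have hV := variance_nonneg id μ
  have hexp : ‖(1 - ((Var[id; μ] * t ^ 2 / 2 : ℝ) : ℂ))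
      - Complex.exp (-(Var[id; μ] * t ^ 2 / 2 : ℝ))‖
      ≤ t ^ 4 / 4 * (Var[id; μ] * (ε ^ 2 + tailSecondMoment μ ε)) :=
    calc _ = |Real.exp (-(Var[id; μ] * t ^ 2 / 2)) - (1 - Var[id; μ] * t ^ 2 / 2)| := by
            rw [norm_sub_rev, ← Real.norm_eq_abs, ← Complex.norm_real]
            push_cast
            rfl
      _ ≤ (Var[id; μ] * t ^ 2 / 2) ^ 2 := abs_exp_neg_sub_one_sub_le_sq (by positivity)
      _ = t ^ 4 / 4 * (Var[id; μ] * Var[id; μ]) := by ring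
      _ ≤ _ := by
          gcongr
          exact variance_le_sq_add_tailSecondMoment hμ h0 ε
  exact (norm_sub_le_norm_sub_add_norm_sub _ _ _).trans
    (add_le_add (norm_charFun_sub_quadratic_le hμ h0 t hε) hexp)

end CenteredLaw

section Lindeberg

theorem norm_charFun_map_sum_sub_exp_le {ι Ω : Type*} [MeasurableSpace Ω] {P : Measure Ω}
    [IsProbabilityMeasure P] {s : Finset ι} {X : ι → Ω → ℝ} (hindep : iIndepFun (s.restrict X) P)
    (hX : ∀ i ∈ s, MemLp (X i) 2 P) (h0 : ∀ i ∈ s, P[X i] = 0) (t : ℝ) {ε : ℝ} (hε : 0 ≤ ε) :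
    ‖charFun (P.map fun ω => ∑ i ∈ s, X i ω) t
        - Complex.exp (-((∑ i ∈ s, Var[X i; P]) * t ^ 2 / 2 : ℝ))‖
      ≤ 4 * |t| ^ 3 * ε * (∑ i ∈ s, Var[X i; P])
        + 4 * t ^ 2 * (∑ i ∈ s, tailSecondMoment (P.map (X i)) ε)
        + t ^ 4 / 4 * ((∑ i ∈ s, Var[X i; P])
          * (ε ^ 2 + ∑ i ∈ s, tailSecondMoment (P.map (X i)) ε)) := by
  have hmeas (i) (hi : i ∈ s) : AEMeasurable (X i) P := (hX i hi).aemeasurable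
  have hlaw (i) (hi : i ∈ s) :
      ‖charFun (P.map (X i)) t - Complex.exp (-(Var[X i; P] * t ^ 2 / 2 : ℝ))‖
        ≤ 4 * |t| ^ 3 * ε * Var[X i; P] + 4 * t ^ 2 * tailSecondMoment (P.map (X i)) ε
          + t ^ 4 / 4 * (Var[X i; P] * (ε ^ 2 + ∑ j ∈ s, tailSecondMoment (P.map (X j)) ε)) := by
    have := Measure.isProbabilityMeasure_map (hmeas i hi)
    have h := norm_charFun_sub_exp_le
      ((memLp_map_measure_iff aestronglyMeasurable_id (hmeas i hi)).2 (hX i hi))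
      ((integral_map (hmeas i hi) aestronglyMeasurable_id).trans (h0 i hi)) t hε
    rw [variance_id_map (hmeas i hi)] at h
    refine h.trans ?_
    gcongr
    · exact variance_nonneg _ _
    · exact Finset.single_le_sum (f := fun j => tailSecondMoment (P.map (X j)) ε)
        (fun _ _ => tailSecondMoment_nonneg _ _) hi
  have hexp : Complex.exp (-((∑ i ∈ s, Var[X i; P]) * t ^ 2 / 2 : ℝ))
      = ∏ i ∈ s, Complex.exp (-(Var[X i; P] * t ^ 2 / 2 : ℝ)) := by
    rw [← Complex.exp_sum, Finset.sum_neg_distrib, Finset.sum_mul, Finset.sum_div,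
      Complex.ofReal_sum]
  rw [hindep.charFun_map_fun_finsetSum_eq_prod hmeas, Finset.prod_apply, hexp]
  refine (norm_prod_sub_prod_le (fun i hi => ?_) fun i _ => ?_).trans
    ((Finset.sum_le_sum hlaw).trans_eq ?_)
  · have := Measure.isProbabilityMeasure_map (hmeas i hi)
    exact norm_charFun_le_one t
  · rw [← Complex.ofReal_neg, Complex.norm_exp_ofReal, Real.exp_le_one_iff, neg_nonpos]
    have := variance_nonneg (X i) P
    positivity
  · simp only [Finset.sum_add_distrib, Finset.mul_sum, Finset.sum_mul]

variable {ι : Type*} {Ω : ℕ → Type*} [∀ n, MeasurableSpace (Ω n)] {P : ∀ n, Measure (Ω n)}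
  [∀ n, IsProbabilityMeasure (P n)] {s : ℕ → Finset ι} {X : ∀ n, ι → Ω n → ℝ} {v : ℝ}

theorem tendsto_charFun_map_sum_of_lindeberg
    (hindep : ∀ n, iIndepFun ((s n).restrict (X n)) (P n))
    (hX : ∀ n, ∀ i ∈ s n, MemLp (X n i) 2 (P n)) (h0 : ∀ n, ∀ i ∈ s n, (P n)[X n i] = 0)
    (hvar : Tendsto (fun n => ∑ i ∈ s n, Var[X n i; P n]) atTop (𝓝 v))
    (hlindeberg : ∀ ε > 0,
      Tendsto (fun n => ∑ i ∈ s n, tailSecondMoment ((P n).map (X n i)) ε) atTop (𝓝 0)) (t : ℝ) :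
    Tendsto (fun n => charFun ((P n).map fun ω => ∑ i ∈ s n, X n i ω) t) atTop
      (𝓝 (Complex.exp (-(v * t ^ 2 / 2 : ℝ)))) := by
  let bound (V L ε : ℝ) : ℝ :=
    4 * |t| ^ 3 * ε * V + 4 * t ^ 2 * L + t ^ 4 / 4 * (V * (ε ^ 2 + L))
  have hbound {ε : ℝ} (hε : 0 < ε) : Tendsto (fun n => bound (∑ i ∈ s n, Var[X n i; P n])
      (∑ i ∈ s n, tailSecondMoment ((P n).map (X n i)) ε) ε) atTop (𝓝 (bound v 0 ε)) :=
    ((hvar.const_mul _).add ((hlindeberg ε hε).const_mul _)).add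
      ((hvar.mul ((hlindeberg ε hε).const_add _)).const_mul _)
  have hbound₀ : Tendsto (bound v 0) (𝓝[>] 0) (𝓝 0) := by
    have hcont : Continuous (bound v 0) := by fun_prop
    simpa [bound] using (hcont.tendsto 0).mono_left nhdsWithin_le_nhds
  have hdiff : Tendsto (fun n => charFun ((P n).map fun ω => ∑ i ∈ s n, X n i ω) t
      - Complex.exp (-((∑ i ∈ s n, Var[X n i; P n]) * t ^ 2 / 2 : ℝ))) atTop (𝓝 0) := by
    refine Metric.tendsto_nhds.2 fun δ hδ => ?_
    obtain ⟨ε, hεδ, hε⟩ :=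
      ((hbound₀.eventually (gt_mem_nhds hδ)).and self_mem_nhdsWithin).exists
    filter_upwards [(hbound hε).eventually (gt_mem_nhds hεδ)] with n hn
    rw [dist_zero_right]
    exact (norm_charFun_map_sum_sub_exp_le (hindep n) (hX n) (h0 n) t (le_of_lt hε)).trans_lt hn
  have hexp : Tendsto (fun n => Complex.exp (-((∑ i ∈ s n, Var[X n i; P n]) * t ^ 2 / 2 : ℝ)))
      atTop (𝓝 (Complex.exp (-(v * t ^ 2 / 2 : ℝ)))) :=
    (Complex.continuous_exp.comp (Complex.continuous_ofReal.neg)).continuousAt.tendsto.comp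
      ((hvar.mul_const _).div_const 2)
  simpa only [sub_add_cancel, zero_add] using hdiff.add hexp

theorem tendstoInDistribution_sum_of_lindeberg {v : NNReal}
    (hindep : ∀ n, iIndepFun ((s n).restrict (X n)) (P n))
    (hX : ∀ n, ∀ i ∈ s n, MemLp (X n i) 2 (P n)) (h0 : ∀ n, ∀ i ∈ s n, (P n)[X n i] = 0)
    (hvar : Tendsto (fun n => ∑ i ∈ s n, Var[X n i; P n]) atTop (𝓝 v))
    (hlindeberg : ∀ ε > 0,
      Tendsto (fun n => ∑ i ∈ s n, tailSecondMoment ((P n).map (X n i)) ε) atTop (𝓝 0)) :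
    TendstoInDistribution (fun n ω => ∑ i ∈ s n, X n i ω) atTop (id : ℝ → ℝ) P
      (gaussianReal 0 v) where
  forall_aemeasurable n := Finset.aemeasurable_fun_sum _ fun i hi => (hX n i hi).aemeasurable
  tendsto := by
    refine ProbabilityMeasure.tendsto_iff_tendsto_charFun.2 fun t => ?_
    simpa [charFun_gaussianReal] using
      tendsto_charFun_map_sum_of_lindeberg hindep hX h0 hvar hlindeberg t

end Lindeberg

theorem isGaussian_map_of_isGaussian_map_const_smul {Ω E : Type*} [MeasurableSpace Ω]
    [NormedAddCommGroup E] [NormedSpace ℝ E] [MeasurableSpace E] [BorelSpace E]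
    {P : Measure Ω} {X : Ω → E} {c : ℝ} (hc : c ≠ 0) (hX : AEMeasurable X P)
    (h : IsGaussian (P.map (c • X))) : IsGaussian (P.map X) := by
  have hlaw : (P.map (c • X)).map (c⁻¹ • ContinuousLinearMap.id ℝ E) = P.map X := by
    rw [AEMeasurable.map_map_of_aemeasurable (by fun_prop) (hX.const_smul c)]
    congr 1
    ext ω
    simp [hc]
  rw [← hlaw]
  infer_instance

theorem isGaussian_map_of_tendstoInDistribution {Ω Ω' E : Type*} [MeasurableSpace Ω]
    [MeasurableSpace Ω'] [NormedAddCommGroup E] [InnerProductSpace ℝ E] [CompleteSpace E]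
    [SecondCountableTopology E] [MeasurableSpace E] [BorelSpace E] {P : Measure Ω}
    {P' : Measure Ω'} [IsProbabilityMeasure P] [IsProbabilityMeasure P'] {X : Ω → E}
    {Y : ℕ → Ω → E} {Z : Ω' → E} {a : ℕ → ℝ} {c : ℝ} (hX : AEMeasurable X P)
    (hY : ∀ n, AEMeasurable (Y n) P) (hXY : ∀ n, IndepFun X (Y n) P)
    (ha : Tendsto a atTop (𝓝 c)) (hc : c ≠ 0)
    (hlim : TendstoInDistribution (fun n => a n • X + Y n) atTop Z (fun _ => P) P')
    (hZ : IsGaussian (P'.map Z)) : IsGaussian (P.map X) := by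
  have hscale : TendstoInDistribution (fun n => a n • X) atTop (c • X) (fun _ => P) P :=
    tendstoInDistribution_of_ae_tendsto (fun n => by fun_prop) (by fun_prop)
      (ae_of_all _ fun ω => ha.smul_const (X ω))
  let ν (n : ℕ) : ProbabilityMeasure E := ⟨P.map (Y n), Measure.isProbabilityMeasure_map (hY n)⟩
  have hconv (n : ℕ) : P.map (a n • X) ∗ (ν n : Measure E) = P.map (a n • X + Y n) :=
    (((hXY n).comp (measurable_const_smul (a n)) measurable_id).map_add_eq_map_conv_map₀
      (by fun_prop) (hY n)).symm
  obtain ⟨ν₀, hν₀⟩ := exists_conv_eq_of_tendsto hscale.tendsto hlim.tendsto hconv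
  have := Measure.isProbabilityMeasure_map hscale.aemeasurable_limit
  exact isGaussian_map_of_isGaussian_map_const_smul hc hX
    (isGaussian_of_isGaussian_conv (ν := (ν₀ : Measure E)) (hν₀ ▸ hZ))

theorem tailSecondMoment_map_const_mul {Ω : Type*} [MeasurableSpace Ω] {P : Measure Ω} {X : Ω → ℝ}
    (hX : AEMeasurable X P) {c : ℝ} (hc : 0 < c) (ε : ℝ) :
    tailSecondMoment (P.map fun ω => c * X ω) ε = c ^ 2 * tailSecondMoment (P.map X) (ε / c) := by
  rw [tailSecondMoment_map (by fun_prop), tailSecondMoment_map hX, ← integral_const_mul]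
  simp only [abs_mul, abs_of_pos hc, div_le_iff₀' hc, mul_pow]

namespace ShmyrovCLT

variable {Ω : Type*} [MeasurableSpace Ω] {P : Measure Ω} {X : Ω → ℝ} {ξ : ℕ → Ω → ℝ}

section TotalVariance

theorem totalVariance_eq_sum (hindep : iIndepFun ξ P) (hL2 : ∀ n, MemLp (ξ n) 2 P) (n : ℕ) :
    totalVariance P ξ n = ∑ k ∈ Finset.range n, Var[ξ k; P] := by
  have hsum : partialSum ξ n = ∑ k ∈ Finset.range n, ξ k := by
    ext ω
    rw [partialSum, Finset.sum_apply]
  rw [totalVariance, hsum]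
  exact IndepFun.variance_sum (fun k _ => hL2 k) fun i _ j _ hij => hindep.indepFun hij

theorem monotone_totalVariance (hindep : iIndepFun ξ P) (hL2 : ∀ n, MemLp (ξ n) 2 P) :
    Monotone (totalVariance P ξ) := by
  refine monotone_nat_of_le_succ fun n => ?_
  rw [totalVariance_eq_sum hindep hL2, totalVariance_eq_sum hindep hL2, Finset.sum_range_succ]
  exact le_add_of_nonneg_right (variance_nonneg _ _)

theorem variance_le_totalVariance (hindep : iIndepFun ξ P) (hL2 : ∀ n, MemLp (ξ n) 2 P)
    {k n : ℕ} (hkn : k < n) : Var[ξ k; P] ≤ totalVariance P ξ n := by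
  rw [totalVariance_eq_sum hindep hL2]
  exact Finset.single_le_sum (f := fun k => Var[ξ k; P]) (fun _ _ => variance_nonneg _ _)
    (Finset.mem_range.2 hkn)

end TotalVariance

section Necessity

theorem isDegenerate_or_isNormal_of_isGaussian (h : IsGaussian (P.map X)) :
    IsDegenerate P X ∨ IsNormal P X := by
  rw [IsDegenerate, IsNormal, h.eq_gaussianReal]
  by_cases hv : Var[id; P.map X].toNNReal = 0
  · exact .inl ⟨_, by rw [hv, gaussianReal_zero_var]⟩
  · exact .inr ⟨_, _, hv, rfl⟩

variable [IsProbabilityMeasure P]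

theorem isDegenerate_of_variance_eq_zero (hX : MemLp X 2 P) (h : Var[X; P] = 0) :
    IsDegenerate P X :=
  ⟨P[X], by rw [Measure.map_congr (ae_eq_integral_of_variance_eq_zero hX h), Measure.map_const,
    measure_univ, one_smul]⟩

theorem isGaussian_map_of_tendstoInDistribution_normalizedSum (hmeas : ∀ n, AEMeasurable (ξ n) P)
    (hindep : iIndepFun ξ P) {L : ℝ} (hL : 0 < L) (hvar : Tendsto (totalVariance P ξ) atTop (𝓝 L))
    (hlim : TendstoInDistribution (normalizedSum P ξ) atTop (id : ℝ → ℝ) (fun _ => P)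
      (gaussianReal 0 1)) (k : ℕ) : IsGaussian (P.map (ξ k)) := by
  let a (n : ℕ) : ℝ := (√(totalVariance P ξ (n + (k + 1))))⁻¹
  let T (n : ℕ) : Finset ℕ := (Finset.range (n + (k + 1))).erase k
  let m (n : ℕ) : ℝ := P[partialSum ξ (n + (k + 1))]
  let Y (n : ℕ) (ω : Ω) : ℝ := a n * ((∑ j ∈ T n, ξ j) ω - m n)
  have hsplit (n : ℕ) : a n • ξ k + Y n = normalizedSum P ξ (n + (k + 1)) := by
    ext ω
    have hk : k ∈ Finset.range (n + (k + 1)) := Finset.mem_range.2 (by lia)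
    simp only [Pi.add_apply, Pi.smul_apply, smul_eq_mul, Y, a, m, T, normalizedSum, partialSum,
      Finset.sum_apply, ← Finset.add_sum_erase _ _ hk]
    ring
  have hindep_sum (n : ℕ) : IndepFun (ξ k) (∑ j ∈ T n, ξ j) P :=
    (hindep.indepFun_finsetSum_of_notMem₀ hmeas (Finset.notMem_erase k _)).symm
  have hindepY (n : ℕ) : IndepFun (ξ k) (Y n) P :=
    (hindep_sum n).comp measurable_id (ψ := fun y => a n * (y - m n)) (by fun_prop)
  have ha : Tendsto a atTop (𝓝 (√L)⁻¹) :=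
    (hvar.sqrt.inv₀ (Real.sqrt_pos.2 hL).ne').comp (tendsto_add_atTop_nat (k + 1))
  have hlim_shift : TendstoInDistribution (fun n => a n • ξ k + Y n) atTop (id : ℝ → ℝ)
      (fun _ => P) (gaussianReal 0 1) := by
    simp only [hsplit]
    exact ⟨fun n => hlim.forall_aemeasurable _, hlim.aemeasurable_limit,
      hlim.tendsto.comp (tendsto_add_atTop_nat (k + 1))⟩
  exact isGaussian_map_of_tendstoInDistribution (hmeas k)
    (fun n => by fun_prop) hindepY ha (by positivity) hlim_shift
    (by rw [Measure.map_id]; infer_instance)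

theorem tendsto_totalVariance_atTop (hindep : iIndepFun ξ P) (hL2 : ∀ n, MemLp (ξ n) 2 P)
    (hns : ¬ IsSingular P ξ)
    (hlim : TendstoInDistribution (normalizedSum P ξ) atTop (id : ℝ → ℝ) (fun _ => P)
      (gaussianReal 0 1)) :
    Tendsto (totalVariance P ξ) atTop atTop := by
  have hmono := monotone_totalVariance hindep hL2
  refine (tendsto_atTop_of_monotone hmono).resolve_right fun ⟨L, hL⟩ => ?_
  obtain ⟨k, hk⟩ := not_forall.1 hns
  have hvar_pos : 0 < Var[ξ k; P] := (variance_nonneg _ _).lt_of_ne fun h =>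
    hk (.inl (isDegenerate_of_variance_eq_zero (hL2 k) h.symm))
  have hL_pos : 0 < L := hvar_pos.trans_le <|
    (variance_le_totalVariance hindep hL2 k.lt_succ_self).trans (hmono.ge_of_tendsto hL (k + 1))
  exact hk (isDegenerate_or_isNormal_of_isGaussian
    (isGaussian_map_of_tendstoInDistribution_normalizedSum (fun n => (hL2 n).aemeasurable)
      hindep hL_pos hL hlim k))

end Necessity

section Sufficiency

theorem normalizedSum_eq_sum (hL1 : ∀ n, Integrable (ξ n) P) (n : ℕ) :
    normalizedSum P ξ n = fun ω =>
      ∑ k ∈ Finset.range n, (√(totalVariance P ξ n))⁻¹ * (ξ k ω - P[ξ k]) := by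
  ext ω
  have hmean : P[partialSum ξ n] = ∑ k ∈ Finset.range n, P[ξ k] :=
    integral_finsetSum _ fun k _ => hL1 k
  rw [normalizedSum, hmean, partialSum, ← Finset.mul_sum, Finset.sum_sub_distrib, div_eq_inv_mul]

variable [IsProbabilityMeasure P]

theorem tailSecondMoment_map_sub_integral_le_variance (hX : MemLp X 2 P) (s : ℝ) :
    tailSecondMoment (P.map fun ω => X ω - P[X]) s ≤ Var[X; P] := by
  have hX_meas := hX.aemeasurable
  rw [tailSecondMoment_map (by fun_prop), variance_eq_integral hX_meas]
  exact setIntegral_le_integral (hX.sub (memLp_const _)).integrable_sq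
    (ae_of_all _ fun ω => sq_nonneg _)

theorem variance_mul_varianceTail (hX : MemLp X 2 P) (s : ℝ) :
    Var[X; P] * varianceTail P X s = tailSecondMoment (P.map fun ω => X ω - P[X]) s := by
  by_cases h : Var[X; P] = 0
  · rw [h, zero_mul]
    exact (tailSecondMoment_nonneg _ _).antisymm
      (h ▸ tailSecondMoment_map_sub_integral_le_variance hX s)
  · have hX_meas := hX.aemeasurable
    rw [varianceTail, if_neg h, ← mul_assoc, mul_one_div_cancel h, one_mul,
      tailSecondMoment_map (by fun_prop),
      setIntegral_map (measurableSet_le measurable_const (by fun_prop)) (by fun_prop) hX_meas]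
    simp only [sq_abs, Set.preimage_ofPred_eq]

theorem varianceTail_le_one (hX : MemLp X 2 P) (s : ℝ) : varianceTail P X s ≤ 1 := by
  by_cases h : Var[X; P] = 0
  · rw [varianceTail, if_pos h]
    exact zero_le_one
  · refine le_of_mul_le_mul_left ?_ ((variance_nonneg _ _).lt_of_ne' h)
    rw [variance_mul_varianceTail hX, mul_one]
    exact tailSecondMoment_map_sub_integral_le_variance hX s

theorem varianceTail_le_iSup (hL2 : ∀ n, MemLp (ξ n) 2 P) (k : ℕ) (s : ℝ) :
    varianceTail P (ξ k) s ≤ ⨆ n, varianceTail P (ξ n) s :=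
  le_ciSup (f := fun n => varianceTail P (ξ n) s)
    ⟨1, Set.forall_mem_range.2 fun n => varianceTail_le_one (hL2 n) s⟩ k

theorem sum_tailSecondMoment_le (hindep : iIndepFun ξ P) (hL2 : ∀ n, MemLp (ξ n) 2 P) {n : ℕ}
    (hn : 0 < totalVariance P ξ n) (ε : ℝ) :
    ∑ k ∈ Finset.range n,
        tailSecondMoment (P.map fun ω => (√(totalVariance P ξ n))⁻¹ * (ξ k ω - P[ξ k])) ε
      ≤ ⨆ k, varianceTail P (ξ k) (ε * √(totalVariance P ξ n)) := by
  set B := √(totalVariance P ξ n) with hB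
  have hB_pos : 0 < B := Real.sqrt_pos.2 hn
  have hB_sq : ∑ k ∈ Finset.range n, Var[ξ k; P] = B ^ 2 := by
    rw [← totalVariance_eq_sum hindep hL2, hB, Real.sq_sqrt hn.le]
  calc ∑ k ∈ Finset.range n, tailSecondMoment (P.map fun ω => B⁻¹ * (ξ k ω - P[ξ k])) ε
      = ∑ k ∈ Finset.range n, B⁻¹ ^ 2 * (Var[ξ k; P] * varianceTail P (ξ k) (ε * B)) := by
        refine Finset.sum_congr rfl fun k _ => ?_
        have hk := (hL2 k).aemeasurable
        rw [tailSecondMoment_map_const_mul (by fun_prop) (inv_pos.2 hB_pos), div_inv_eq_mul,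
          variance_mul_varianceTail (hL2 k)]
    _ ≤ ∑ k ∈ Finset.range n, B⁻¹ ^ 2 * (Var[ξ k; P] * ⨆ j, varianceTail P (ξ j) (ε * B)) := by
        gcongr with k
        · exact variance_nonneg _ _
        · exact varianceTail_le_iSup hL2 k _
    _ = ⨆ j, varianceTail P (ξ j) (ε * B) := by
        rw [← Finset.mul_sum, ← Finset.sum_mul, hB_sq]
        field_simp

theorem sum_variance_normalized_eq_one (hindep : iIndepFun ξ P) (hL2 : ∀ n, MemLp (ξ n) 2 P)
    {n : ℕ} (hn : 0 < totalVariance P ξ n) :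
    ∑ k ∈ Finset.range n, Var[fun ω => (√(totalVariance P ξ n))⁻¹ * (ξ k ω - P[ξ k]); P] = 1 := by
  simp only [variance_const_mul, variance_sub_const (hL2 _).aestronglyMeasurable]
  rw [← Finset.mul_sum, ← totalVariance_eq_sum hindep hL2, inv_pow, Real.sq_sqrt hn.le,
    inv_mul_cancel₀ hn.ne']

theorem tendstoInDistribution_normalizedSum (hindep : iIndepFun ξ P)
    (hL2 : ∀ n, MemLp (ξ n) 2 P) (hunif : UniformConvergenceCondition P ξ)
    (hvar : Tendsto (totalVariance P ξ) atTop atTop) :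
    TendstoInDistribution (normalizedSum P ξ) atTop (id : ℝ → ℝ) (fun _ => P)
      (gaussianReal 0 1) := by
  have hL1 (k : ℕ) : Integrable (ξ k) P := (hL2 k).integrable one_le_two
  rw [funext (normalizedSum_eq_sum hL1)]
  refine tendstoInDistribution_sum_of_lindeberg (fun n => ?_) (fun n k _ => ?_) (fun n k _ => ?_)
    ?_ fun ε hε => ?_
  · exact (hindep.comp (fun k x => (√(totalVariance P ξ n))⁻¹ * (x - P[ξ k]))
      fun k => by fun_prop).restrict _
  · exact ((hL2 k).sub (memLp_const _)).const_mul _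
  · rw [integral_const_mul, integral_sub (hL1 k) (integrable_const _), integral_const,
      probReal_univ, one_smul, sub_self, mul_zero]
  · refine tendsto_const_nhds.congr' ?_
    filter_upwards [hvar.eventually_gt_atTop 0] with n hn
    exact (sum_variance_normalized_eq_one hindep hL2 hn).symm
  · have hB : Tendsto (fun n => ε * √(totalVariance P ξ n)) atTop atTop :=
      (Real.tendsto_sqrt_atTop.comp hvar).const_mul_atTop hε
    refine squeeze_zero' (.of_forall fun n => Finset.sum_nonneg fun k _ =>
      tailSecondMoment_nonneg _ _) ?_ (hunif.comp hB)
    filter_upwards [hvar.eventually_gt_atTop 0] with n hn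
    exact sum_tailSecondMoment_le hindep hL2 hn ε

end Sufficiency

end ShmyrovCLT

theorem theorem1 {Ω : Type*} [MeasurableSpace Ω] (P : Measure Ω) [IsProbabilityMeasure P]
    (ξ : ℕ → Ω → ℝ) (hmeas : ∀ n, Measurable (ξ n)) (hindep : iIndepFun ξ P)
    (hL2 : ∀ n, MemLp (ξ n) 2 P)
    (hns : ¬ ShmyrovCLT.IsSingular P ξ)
    (hunif : ShmyrovCLT.UniformConvergenceCondition P ξ) :
    TendstoInDistribution (ShmyrovCLT.normalizedSum P ξ) atTop (id : ℝ → ℝ)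
        (fun _ => P) (gaussianReal 0 1) ↔
      Tendsto (ShmyrovCLT.totalVariance P ξ) atTop atTop :=
  ⟨ShmyrovCLT.tendsto_totalVariance_atTop hindep hL2 hns,
    ShmyrovCLT.tendstoInDistribution_normalizedSum hindep hL2 hunif⟩
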